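/- Let $p\ge 1$, $\boldsymbol\mu\in\mathbb R^p$, and $\mathbf X_i=\boldsymbol\mu+\boldsymbol\epsilon_i$, $i=1,2,\dots$, where the errors $\boldsymbol\epsilon_i=(\epsilon_{i1},\dots,\epsilon_{ip})$ are i.i.d. random vectors in $\mathbb R^p$ with zero mean that belong to $DS(\alpha_1,\dots,\alpha_p)$ with $1<\alpha_j\le 2$ for all $j$. This means that there are $a_n^{(j)}>0$ and $\mathbf b_n\in\mathbb R^p$ such that $$\Big(\sum_{i=1}^n\epsilon_{i1}/a_n^{(1)},\dots,\sum_{i=1}^n\epsilon_{ip}/a_n^{(p)}\Big)-\mathbf b_n\xrightarrow{d}\mathbf Y,$$ where $\mathbf Y$ has a stable law with indices $(\alpha_1,\dots,\alpha_p)$: its coordinates are non-degenerate, and for every $n\ge1$ the sum of $n$ independent copies of $\mathbf Y$ has the same law as $(n^{1/\alpha_1}Y_1,\dots,n^{1/\alpha_p}Y_p)+\mathbf c_n$ for some $\mathbf c_n\in\mathbb R^p$. Let $\rho(x_1,\dots,x_p)=\rho_1(x_1)+\dots+\rho_p(x_p)$ where, for each $j=1,\dots,p$: (A1) $\rho_j:\mathbb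 R\to\mathbb R$ is convex and twice differentiable; put $\psi_j=\rho_j'$, $\psi_j'=\rho_j''$; (A2) $E\,\psi_j(\epsilon_{1j})=0$, $E\,\psi_j^2(\epsilon_{1j})<\infty$ and $0<|E\,\psi_j'(\epsilon_{1j})|<\infty$; (A3) $\psi_j'$ is Lipschitz continuous on $\mathbb R$. For each $n$ let $\hat{\boldsymbol\mu}_M=\hat{\boldsymbol\mu}_{M,n}$ be an M-estimator, that is, a random vector that almost surely minimizes $\boldsymbol\beta\mapsto\sum_{i=1}^n\rho(\mathbf X_i-\boldsymbol\beta)$ over $\mathbb R^p$. Then, as $n\to\infty$, $$\sqrt n\,(\hat{\boldsymbol\mu}_M-\boldsymbol\mu)\xrightarrow{d}N\big(\mathbf 0,\ \digamma^{-1}\Gamma\digamma^{-1}\big),$$ where $\digamma=\mathrm{diag}\big(E\,\psi_1'(\epsilon_{11}),\dots,E\,\psi_p'(\epsilon_{1p})\big)$ and $\Gamma=(\gamma_{jk})$ is the $p\times p$ matrix with $\gamma_{jk}=\mathrm{Cov}\big(\psi_j(\epsilon_{1j}),\psi_k(\epsilon_{1k})\big)=E\big[\psi_j(\epsilon_{1j})\psi_k(\epsilon_{1k})\big]$.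 -/

import Mathlib

open MeasureTheory ProbabilityTheory Filter Topology

/-- `ν` is a stable law on `ℝᵖ` with (possibly different) indices of stability `α₁, …, α_p`:
all one-dimensional marginals are non-degenerate and, for every `n ≥ 1`, the sum of `n` independent
vectors with law `ν` has the law of `(n^{1/α₁} Y₁ + c₁, …, n^{1/α_p} Y_p + c_p)`, where `Y ∼ ν`
and `c` is a constant vector depending on `n`. -/
structure IsStableLaw {p : ℕ} (α : Fin p → ℝ) (ν : Measure (EuclideanSpace ℝ (Fin p))) :
    Prop where
  index_mem : ∀ j, α j ∈ Set.Ioc (0 : ℝ) 2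
  nondegenerate : ∀ (j : Fin p) (c : ℝ), ¬ ∀ᵐ y ∂ν, y j = c
  stable : ∀ n : ℕ, 1 ≤ n → ∃ c : Fin p → ℝ,
    (Measure.pi fun _ : Fin n => ν).map (fun y => ∑ i, y i) =
      ν.map (fun y => WithLp.toLp 2 fun j => (n : ℝ) ^ (1 / α j) * y j + c j)

/-- The i.i.d. random vectors `ξ 0, ξ 1, …` belong to `DS(α₁, …, α_p)`: with coordinatewise
positive norming constants `a n j` and centring vectors `b n`, the vector of normalised coordinates
of the partial sums converges in distribution to a stable law with indices `α₁, …, α_p`. -/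
def InDS {p : ℕ} (α : Fin p → ℝ) {Ω : Type*} [MeasurableSpace Ω] (P : Measure Ω)
    [IsProbabilityMeasure P] (ξ : ℕ → Ω → EuclideanSpace ℝ (Fin p)) : Prop :=
  ∃ (ν : ProbabilityMeasure (EuclideanSpace ℝ (Fin p))) (a b : ℕ → Fin p → ℝ),
    IsStableLaw α (ν : Measure (EuclideanSpace ℝ (Fin p))) ∧
    (∀ n j, 0 < a n j) ∧
    TendstoInDistribution
      (fun n ω => WithLp.toLp 2 fun j => (∑ i ∈ Finset.range n, ξ i ω j) / a n j - b n j)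
      atTop id (fun _ => P) (ν : Measure (EuclideanSpace ℝ (Fin p)))

/-- The separable loss `ρ(x₁, …, x_p) = ρ₁(x₁) + ⋯ + ρ_p(x_p)`. -/
def separableLoss {p : ℕ} (ρ : Fin p → ℝ → ℝ) (x : EuclideanSpace ℝ (Fin p)) : ℝ :=
  ∑ j, ρ j (x j)

/-- `β` is an M-estimate from the observations `x 0, …, x (n - 1)`: it minimises
`b ↦ ∑ i < n, ρ (x i - b)` over `ℝᵖ`. -/
def IsMEstimate {p : ℕ} (ρ : Fin p → ℝ → ℝ) (n : ℕ) (x : ℕ → EuclideanSpace ℝ (Fin p))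
    (β : EuclideanSpace ℝ (Fin p)) : Prop :=
  IsMinOn (fun b => ∑ i ∈ Finset.range n, separableLoss ρ (x i - b)) Set.univ β

/-- The matrix `diag(E ψ₁'(ε₁), …, E ψ_p'(ε_p))` with `ψ_j = ρ_j'`. -/
noncomputable def digammaMatrix {p : ℕ} (ρ : Fin p → ℝ → ℝ) {Ω : Type*} [MeasurableSpace Ω]
    (P : Measure Ω) (e : Ω → EuclideanSpace ℝ (Fin p)) : Matrix (Fin p) (Fin p) ℝ :=
  Matrix.diagonal fun j => ∫ ω, deriv (deriv (ρ j)) (e ω j) ∂P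

/-- The matrix with entries `E[ψ_j(ε_j) ψ_k(ε_k)]`, with `ψ_j = ρ_j'`. -/
noncomputable def gammaMatrix {p : ℕ} (ρ : Fin p → ℝ → ℝ) {Ω : Type*} [MeasurableSpace Ω]
    (P : Measure Ω) (e : Ω → EuclideanSpace ℝ (Fin p)) : Matrix (Fin p) (Fin p) ℝ :=
  Matrix.of fun j k => ∫ ω, deriv (ρ j) (e ω j) * deriv (ρ k) (e ω k) ∂P

/-- The sandwich covariance matrix `Ϝ⁻¹ Γ Ϝ⁻¹`. -/
noncomputable def asymptoticCov {p : ℕ} (ρ : Fin p → ℝ → ℝ) {Ω : Type*} [MeasurableSpace Ω]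
    (P : Measure Ω) (e : Ω → EuclideanSpace ℝ (Fin p)) : Matrix (Fin p) (Fin p) ℝ :=
  (digammaMatrix ρ P e)⁻¹ * gammaMatrix ρ P e * (digammaMatrix ρ P e)⁻¹

/-!
The `j`-th coordinate of `√n (μ̂ - μ)` is a root of the decreasing random function
`v ↦ (√n)⁻¹ ∑ ψ_j (ε_ij - v / √n)`. As `ψ_j'` is Lipschitz, Taylor's formula puts this function
within `K v² / √n` of the line `Z_n - v A_n`, where `Z_n = (√n)⁻¹ ∑ ψ_j (ε_ij)` is bounded in
probability by Chebyshev's inequality and `A_n = n⁻¹ ∑ ψ_j' (ε_ij)` tends to `E ψ_j' > 0` by the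
law of large numbers. Monotonicity therefore forces the root into a bounded interval, on which the
quadratic error vanishes, so the root is `Z_n / E ψ_j' + o_P(1)`. Hence `√n (μ̂ - μ)` has the same
limit as `(√n)⁻¹ ∑ Ϝ⁻¹ ψ(ε_i)`, and the multivariate central limit theorem, obtained from the real
one through characteristic functions, yields the covariance `Ϝ⁻¹ Γ Ϝ⁻¹`.
-/

section CentralLimit

open scoped RealInnerProductSpace

variable {Ω Ω' E : Type*} [MeasurableSpace Ω] [MeasurableSpace Ω'] {P : Measure Ω}
  [NormedAddCommGroup E] [InnerProductSpace ℝ E] [MeasurableSpace E] [BorelSpace E]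

lemma charFun_map_eq_charFun_map_inner {Y : Ω → E} (hY : AEMeasurable Y P) (t : E) :
    charFun (P.map Y) t = charFun (P.map fun ω => ⟪t, Y ω⟫) 1 := by
  rw [charFun_eq_charFunDual_toDualMap, charFunDual_eq_charFun_map_one,
    AEMeasurable.map_map_of_aemeasurable (by fun_prop) hY]
  rfl

variable [FiniteDimensional ℝ E] [IsProbabilityMeasure P]

theorem tendstoInDistribution_of_forall_inner {P' : Measure Ω'} [IsProbabilityMeasure P']
    {X : ℕ → Ω → E} {Y : Ω' → E} (hX : ∀ n, AEMeasurable (X n) P) (hY : AEMeasurable Y P')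
    (h : ∀ t : E, TendstoInDistribution (fun n ω => ⟪t, X n ω⟫) atTop (fun ω => ⟪t, Y ω⟫)
      (fun _ => P) P') :
    TendstoInDistribution X atTop Y (fun _ => P) P' := by
  refine ⟨hX, hY, ProbabilityMeasure.tendsto_iff_tendsto_charFun.2 fun t => ?_⟩
  simpa only [ProbabilityMeasure.coe_mk, charFun_map_eq_charFun_map_inner (hX _),
    charFun_map_eq_charFun_map_inner hY] using
    ProbabilityMeasure.tendsto_iff_tendsto_charFun.1 (h t).tendsto 1

theorem tendstoInDistribution_inv_sqrt_smul_sum_sub {W : ℕ → Ω → E} (hindep : iIndepFun W P)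
    (hident : ∀ i, IdentDistrib (W i) (W 0) P P) (hW : MemLp (W 0) 2 P)
    {ν : Measure E} [IsGaussian ν] (hmean : ν[id] = 0)
    (hcov : covarianceBilin ν = covarianceBilin (P.map (W 0))) :
    TendstoInDistribution
      (fun (n : ℕ) ω => (√(n : ℝ))⁻¹ • (∑ i ∈ Finset.range n, W i ω - (n : ℝ) • P[W 0]))
      atTop id (fun _ => P) ν := by
  have hWm (i : ℕ) : AEMeasurable (W i) P := (hident i).aemeasurable_fst
  refine tendstoInDistribution_of_forall_inner (fun n => by fun_prop) aemeasurable_id fun t => ?_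
  have hm : Measurable fun x : E => ⟪t, x⟫ := by fun_prop
  have hmean_t : ∫ x, ⟪t, x⟫ ∂ν = 0 := by
    have h := integral_inner (𝕜 := ℝ) (f := id) (IsGaussian.integrable_id (μ := ν)) t
    rwa [hmean, inner_zero_right] at h
  have hvar_t : Var[fun x => ⟪t, x⟫; ν] = Var[fun ω => ⟪t, W 0 ω⟫; P] := by
    have hW' : MemLp id 2 (P.map (W 0)) :=
      (memLp_map_measure_iff aestronglyMeasurable_id (hWm 0)).2 hW
    rw [← covarianceBilin_self IsGaussian.memLp_two_id, hcov, covarianceBilin_self hW',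
      variance_map hm.aemeasurable (hWm 0)]
    rfl
  have hlaw : HasLaw (fun x => ⟪t, x⟫) (gaussianReal 0 Var[fun ω => ⟪t, W 0 ω⟫; P].toNNReal) ν := by
    refine ⟨hm.aemeasurable, ?_⟩
    simpa [hmean_t, hvar_t] using IsGaussian.map_eq_gaussianReal (μ := ν) (innerSL ℝ t)
  have hclt := tendstoInDistribution_inv_sqrt_mul_sum_sub (P := P) (X := fun i ω => ⟪t, W i ω⟫)
    hlaw (hW.const_inner t) (hindep.comp (fun _ x => ⟪t, x⟫) fun _ => hm)
    fun i => (hident i).comp hm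
  have hcomm (n : ℕ) (ω : Ω) :
      ⟪t, (√(n : ℝ))⁻¹ • (∑ i ∈ Finset.range n, W i ω - (n : ℝ) • P[W 0])⟫ =
        (√(n : ℝ))⁻¹ * (∑ i ∈ Finset.range n, ⟪t, W i ω⟫ - n * P[fun ω => ⟪t, W 0 ω⟫]) := by
    rw [real_inner_smul_right, inner_sub_right, inner_sum, real_inner_smul_right,
      integral_inner (hW.integrable one_le_two)]
  simp only [hcomm]
  exact hclt

end CentralLimit

section CovarianceMatrix

open scoped Matrix

variable {ι Ω : Type*} [Fintype ι] [MeasurableSpace Ω] {P : Measure Ω}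

/-- The covariance matrix of a random vector `X`: the covariance parameter of the Gaussian limit in
the central limit theorem. -/
noncomputable def covarianceMatrix (X : Ω → EuclideanSpace ℝ ι) (P : Measure Ω) : Matrix ι ι ℝ :=
  Matrix.of fun j k => cov[fun ω => X ω j, fun ω => X ω k; P]

variable {κ : Type*} {X : Ω → EuclideanSpace ℝ ι}

lemma memLp_toLp_mulVec [Fintype κ] {q : ENNReal} (hX : MemLp X q P) (A : Matrix κ ι ℝ) :
    MemLp (fun ω => WithLp.toLp 2 (A *ᵥ X ω)) q P := by
  classical exact (Matrix.toLpLin 2 2 A).toContinuousLinearMap.comp_memLp' hX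

lemma integral_toLp_mulVec [Fintype κ] (hX : Integrable X P) (A : Matrix κ ι ℝ) :
    ∫ ω, WithLp.toLp 2 (A *ᵥ X ω) ∂P = WithLp.toLp 2 (A *ᵥ WithLp.ofLp (∫ ω, X ω ∂P)) := by
  classical exact (Matrix.toLpLin 2 2 A).toContinuousLinearMap.integral_comp_comm hX

variable [IsFiniteMeasure P]

lemma dotProduct_covarianceMatrix_mulVec (hX : MemLp X 2 P) (x y : EuclideanSpace ℝ ι) :
    x ⬝ᵥ covarianceMatrix X P *ᵥ y = covarianceBilin (P.map X) x y := by
  have h := covarianceBilin_apply_pi (fun j => hX.eval_piLp j) x y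
  simp only [covarianceMatrix, dotProduct, Matrix.mulVec, Matrix.of_apply, Finset.mul_sum, h]
  refine Finset.sum_congr rfl fun j _ => Finset.sum_congr rfl fun k _ => ?_
  ring

lemma posSemidef_covarianceMatrix (hX : MemLp X 2 P) : (covarianceMatrix X P).PosSemidef := by
  refine .of_dotProduct_mulVec_nonneg ?_ fun x => ?_
  · exact Matrix.IsHermitian.ext fun j k => covariance_comm _ _
  · exact (covarianceBilin_self_nonneg _).trans_eq
      (dotProduct_covarianceMatrix_mulVec hX (WithLp.toLp 2 x) (WithLp.toLp 2 x)).symm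

lemma covarianceMatrix_toLp_mulVec (hX : MemLp X 2 P) (A : Matrix κ ι ℝ) :
    covarianceMatrix (fun ω => WithLp.toLp 2 (A *ᵥ X ω)) P = A * covarianceMatrix X P * Aᵀ := by
  ext j k
  have hX' (j : κ) (l : ι) : MemLp (fun ω => A j l * X ω l) 2 P := (hX.eval_piLp l).const_mul _
  simp only [covarianceMatrix, Matrix.of_apply, Matrix.mulVec, dotProduct, Matrix.mul_apply,
    Matrix.transpose_apply, Finset.sum_mul, covariance_fun_sum_fun_sum (hX' j) (hX' k),
    covariance_const_mul_left, covariance_const_mul_right]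
  rw [Finset.sum_comm]
  refine Finset.sum_congr rfl fun l _ => Finset.sum_congr rfl fun m _ => ?_
  ring

theorem tendstoInDistribution_multivariateGaussian [DecidableEq ι] [IsProbabilityMeasure P]
    {W : ℕ → Ω → EuclideanSpace ℝ ι} (hindep : iIndepFun W P)
    (hident : ∀ i, IdentDistrib (W i) (W 0) P P) (hW : MemLp (W 0) 2 P) (hmean : P[W 0] = 0) :
    TendstoInDistribution (fun (n : ℕ) ω => (√(n : ℝ))⁻¹ • ∑ i ∈ Finset.range n, W i ω) atTop id
      (fun _ => P) (multivariateGaussian 0 (covarianceMatrix (W 0) P)) := by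
  simpa [hmean] using tendstoInDistribution_inv_sqrt_smul_sum_sub hindep hident hW
    integral_id_multivariateGaussian' (by
      ext x y
      rw [covarianceBilin_multivariateGaussian (posSemidef_covarianceMatrix hW),
        dotProduct_covarianceMatrix_mulVec hW])

end CovarianceMatrix

section ConvergenceInProbability

open scoped ENNReal

variable {Ω κ : Type*} [MeasurableSpace Ω] {P : Measure Ω} {l : Filter κ}

lemma tendstoInMeasure_piLp {ι : Type*} [Fintype ι] {q : ℝ≥0∞} [Fact (1 ≤ q)] {β : ι → Type*}
    [∀ j, PseudoEMetricSpace (β j)] {D : κ → Ω → PiLp q β} {D₀ : Ω → PiLp q β}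
    (h : ∀ j, TendstoInMeasure P (fun n ω => D n ω j) l fun ω => D₀ ω j) :
    TendstoInMeasure P D l D₀ := by
  intro η hη
  obtain ⟨K, hK⟩ : ∃ K, AntilipschitzWith K (WithLp.ofLp : PiLp q β → ∀ j, β j) :=
    ⟨_, PiLp.antilipschitzWith_ofLp q β⟩
  have hηK : 0 < η / K := ENNReal.div_pos hη.ne' ENNReal.coe_ne_top
  have hsum : Tendsto (fun n => ∑ j, P {ω | η / K ≤ edist (D n ω j) (D₀ ω j)}) l (𝓝 0) := by
    simpa using tendsto_finsetSum Finset.univ fun j _ => h j (η / K) hηK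
  refine tendsto_of_tendsto_of_tendsto_of_le_of_le tendsto_const_nhds hsum (fun _ => zero_le)
    fun n => (measure_mono fun ω hω => ?_).trans (measure_iUnion_fintype_le P _)
  by_contra hsmall
  simp only [Set.mem_iUnion, Set.mem_ofPred_eq, not_exists, not_le] at hsmall hω
  have hlt : edist (D n ω).ofLp (D₀ ω).ofLp < η / K :=
    (Finset.sup_lt_iff hηK).2 fun j _ => hsmall j
  exact ((hK _ _).trans_lt (ENNReal.mul_lt_of_lt_div' hlt)).not_ge hω

/-- The family `Z` is bounded in probability along `l`, i.e. `Z n = O_P(1)`. -/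
def IsBoundedInProbability {E : Type*} [Norm E] (P : Measure Ω) (l : Filter κ)
    (Z : κ → Ω → E) : Prop :=
  ∀ r : ℝ≥0∞, 0 < r → ∃ M : ℝ, 0 < M ∧ ∀ᶠ n in l, P {ω | M ≤ ‖Z n ω‖} ≤ r

lemma isBoundedInProbability_of_variance_le [IsFiniteMeasure P] {Z : κ → Ω → ℝ}
    (hZ : ∀ n, MemLp (Z n) 2 P) (hmean : ∀ n, P[Z n] = 0) {C : ℝ} (hvar : ∀ n, Var[Z n; P] ≤ C) :
    IsBoundedInProbability P l Z := by
  intro r hr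
  have hlim : Tendsto (fun M : ℝ => ENNReal.ofReal (C / M ^ 2)) atTop (𝓝 0) := by
    rw [← ENNReal.ofReal_zero]
    exact ENNReal.tendsto_ofReal
      (tendsto_const_nhds.div_atTop (tendsto_pow_atTop two_ne_zero))
  obtain ⟨M, hM, hMr⟩ :=
    ((eventually_gt_atTop 0).and (ENNReal.tendsto_nhds_zero.1 hlim r hr)).exists
  refine ⟨M, hM, Eventually.of_forall fun n => le_trans ?_ hMr⟩
  have hcheb := meas_ge_le_variance_div_sq (hZ n) hM
  simp only [hmean, sub_zero] at hcheb
  exact hcheb.trans (ENNReal.ofReal_le_ofReal (by gcongr; exact hvar n))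

lemma variance_inv_sqrt_mul_sum_le {V : ℕ → Ω → ℝ}
    (hindep : Pairwise fun i j => V i ⟂ᵢ[P] V j) (hident : ∀ i, IdentDistrib (V i) (V 0) P P)
    (hV : MemLp (V 0) 2 P) (n : ℕ) :
    Var[fun ω => (√(n : ℝ))⁻¹ * ∑ i ∈ Finset.range n, V i ω; P] ≤ Var[V 0; P] := by
  have hsum : (fun ω => ∑ i ∈ Finset.range n, V i ω) = ∑ i ∈ Finset.range n, V i := by
    ext ω
    rw [Finset.sum_apply]
  rw [variance_const_mul, hsum, IndepFun.variance_sum (fun i _ => (hident i).memLp_iff.2 hV)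
    (hindep.set_pairwise _)]
  simp only [(hident _).variance_eq, Finset.sum_const, Finset.card_range, nsmul_eq_mul, inv_pow,
    Real.sq_sqrt n.cast_nonneg, ← mul_assoc]
  exact mul_le_of_le_one_left (variance_nonneg _ _) inv_mul_le_one

end ConvergenceInProbability

section AsymptoticallyLinearRoot

lemma abs_lt_of_antitone_of_root {F : ℝ → ℝ} (hF : Antitone F) {Z A d k M u : ℝ} (hM : 0 < M)
    (hlin : ∀ v, |F v - (Z - v * A)| ≤ k * v ^ 2) (hu : F u = 0) (hZ : |Z| < M * d / 4)
    (hA : |A - d| < d / 2) (hk : k * M ^ 2 < M * d / 4) : |u| < M := by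
  rw [abs_lt] at hZ hA
  have hMA : M * d / 2 < M * A := by nlinarith
  have hneg : F M < 0 := by linarith [(abs_le.1 (hlin M)).2]
  have hpos : 0 < F (-M) := by
    have h := (abs_le.1 (hlin (-M))).1
    rw [neg_sq] at h
    linarith
  rw [abs_lt]
  exact ⟨hF.reflect_lt (hu ▸ hpos), hF.reflect_lt (hu ▸ hneg)⟩

lemma abs_sub_div_lt_of_abs_mul_sub_le {Z A d k M u η : ℝ} (hd : d ≠ 0) (hη : 0 < η)
    (hlin : |u * A - Z| ≤ k * u ^ 2) (hu : |u| < M) (hA : |A - d| < η * |d| / (2 * M))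
    (hk : |k| * M ^ 2 < η * |d| / 2) : |u - Z / d| < η := by
  have hM : 0 < M := (abs_nonneg u).trans_lt hu
  have hslope : |u * (d - A)| ≤ η * |d| / 2 := calc
    |u * (d - A)| = |u| * |A - d| := by rw [abs_mul, abs_sub_comm]
    _ ≤ M * (η * |d| / (2 * M)) := by gcongr
    _ = η * |d| / 2 := by field_simp
  have hremainder : |u * A - Z| < η * |d| / 2 := calc
    |u * A - Z| ≤ |k| * |u| ^ 2 := hlin.trans (by rw [sq_abs]; gcongr; exact le_abs_self k)
    _ ≤ |k| * M ^ 2 := by gcongr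
    _ < η * |d| / 2 := hk
  have hsplit : u - Z / d = (u * (d - A) + (u * A - Z)) / d := by
    field_simp
    ring
  rw [hsplit, abs_div, div_lt_iff₀ (abs_pos.2 hd)]
  linarith [abs_add_le (u * (d - A)) (u * A - Z)]

variable {Ω κ : Type*} [MeasurableSpace Ω] {P : Measure Ω} {l : Filter κ} {Z A U : κ → Ω → ℝ}
  {d : ℝ} {k : κ → ℝ}

theorem IsBoundedInProbability.of_antitone_root {F : κ → Ω → ℝ → ℝ}
    (hF : ∀ n ω, Antitone (F n ω))
    (hlin : ∀ n ω v, |F n ω v - (Z n ω - v * A n ω)| ≤ k n * v ^ 2)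
    (hU : ∀ n, ∀ᵐ ω ∂P, F n ω (U n ω) = 0) (hZ : IsBoundedInProbability P l Z)
    (hA : TendstoInMeasure P A l fun _ => d) (hd : 0 < d) (hk : Tendsto k l (𝓝 0)) :
    IsBoundedInProbability P l U := by
  intro r hr
  have hr2 : 0 < r / 2 := ENNReal.half_pos hr.ne'
  obtain ⟨M₀, hM₀, hZM⟩ := hZ (r / 2) hr2
  set M := 4 * M₀ / d
  have hM : 0 < M := by positivity
  have hMd : M * d / 4 = M₀ := by simp only [M]; field_simp
  have hkM : Tendsto (fun n => k n * M ^ 2) l (𝓝 0) := by simpa using hk.mul_const (M ^ 2)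
  refine ⟨M, hM, ?_⟩
  filter_upwards [hZM, ENNReal.tendsto_nhds_zero.1
    (tendstoInMeasure_iff_norm.1 hA (d / 2) (half_pos hd)) (r / 2) hr2,
    hkM.eventually_lt_const hM₀] with n hZn hAn hkn
  rw [← ENNReal.add_halves r]
  refine (measure_mono_ae ?_).trans ((measure_union_le _ _).trans (add_le_add hZn hAn))
  filter_upwards [hU n] with ω hω hlarge
  by_contra hgood
  obtain ⟨hZω, hAω⟩ : ‖Z n ω‖ < M₀ ∧ ‖A n ω - d‖ < d / 2 :=
    (not_or.1 hgood).imp not_le.1 not_le.1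
  exact (abs_lt_of_antitone_of_root (hF n ω) hM (hlin n ω) hω (hMd ▸ hZω) hAω
    (hMd ▸ hkn)).not_ge hlarge

theorem tendstoInMeasure_sub_div_of_abs_mul_sub_le
    (hlin : ∀ n, ∀ᵐ ω ∂P, |U n ω * A n ω - Z n ω| ≤ k n * U n ω ^ 2)
    (hU : IsBoundedInProbability P l U) (hA : TendstoInMeasure P A l fun _ => d) (hd : d ≠ 0)
    (hk : Tendsto k l (𝓝 0)) : TendstoInMeasure P (fun n ω => U n ω - Z n ω / d) l 0 := by
  simp only [tendstoInMeasure_iff_norm, Pi.zero_apply, sub_zero] at hA ⊢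
  intro η hη
  rw [ENNReal.tendsto_nhds_zero]
  intro r hr
  have hr2 : 0 < r / 2 := ENNReal.half_pos hr.ne'
  obtain ⟨M, hM, hUM⟩ := hU (r / 2) hr2
  have hkM : Tendsto (fun n => |k n| * M ^ 2) l (𝓝 0) := by simpa using hk.abs.mul_const (M ^ 2)
  filter_upwards [hUM, ENNReal.tendsto_nhds_zero.1 (hA (η * |d| / (2 * M)) (by positivity))
    (r / 2) hr2, hkM.eventually_lt_const (show 0 < η * |d| / 2 by positivity)] with n hUn hAn hkn
  rw [← ENNReal.add_halves r]
  refine (measure_mono_ae ?_).trans ((measure_union_le _ _).trans (add_le_add hUn hAn))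
  filter_upwards [hlin n] with ω hω hlarge
  by_contra hgood
  obtain ⟨hUω, hAω⟩ : ‖U n ω‖ < M ∧ ‖A n ω - d‖ < η * |d| / (2 * M) :=
    (not_or.1 hgood).imp not_le.1 not_le.1
  exact (abs_sub_div_lt_of_abs_mul_sub_le hd hη hω hUω hAω hkn).not_ge hlarge

end AsymptoticallyLinearRoot

section LocalScore

lemma norm_sub_sub_smul_deriv_le {𝕜 F : Type*} [RCLike 𝕜] [NormedAddCommGroup F]
    [NormedSpace 𝕜 F] {f : 𝕜 → F} (hf : Differentiable 𝕜 f) {K : NNReal}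
    (hK : LipschitzWith K (deriv f)) (x y : 𝕜) :
    ‖f y - f x - (y - x) • deriv f x‖ ≤ K * ‖y - x‖ ^ 2 := by
  set φ : 𝕜 →L[𝕜] F := .toSpanSingleton 𝕜 (deriv f x)
  have hbound : ∀ z ∈ Metric.closedBall x ‖y - x‖,
      ‖ContinuousLinearMap.toSpanSingleton 𝕜 (deriv f z) - φ‖ ≤ K * ‖y - x‖ := by
    intro z hz
    have hφ : .toSpanSingleton 𝕜 (deriv f z) - φ =
        .toSpanSingleton 𝕜 (deriv f z - deriv f x) := by
      ext
      simp [φ]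
    rw [hφ, ContinuousLinearMap.norm_toSpanSingleton, ← dist_eq_norm]
    exact (hK.dist_le_mul z x).trans (by gcongr; exact hz)
  have h := (convex_closedBall x ‖y - x‖).norm_image_sub_le_of_norm_hasFDerivWithin_le'
    (fun z _ => (hf z).hasDerivAt.hasFDerivAt.hasFDerivWithinAt) hbound
    (Metric.mem_closedBall_self (norm_nonneg _)) (mem_closedBall_iff_norm.2 le_rfl)
  rwa [ContinuousLinearMap.toSpanSingleton_apply, mul_assoc, ← sq] at h

/-- The score of the observations `x 0, …, x (n - 1)` in the local parametrisation `v = √n δ` of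
the shift `δ`, normalised by `√n`; the rescaled error of an M-estimate is a root of it. -/
noncomputable def localScore (ψ : ℝ → ℝ) (n : ℕ) (x : ℕ → ℝ) (v : ℝ) : ℝ :=
  (√(n : ℝ))⁻¹ * ∑ i ∈ Finset.range n, ψ (x i - v / √(n : ℝ))

lemma antitone_localScore {ψ : ℝ → ℝ} (hψ : Monotone ψ) (n : ℕ) (x : ℕ → ℝ) :
    Antitone (localScore ψ n x) := fun v w hvw =>
  mul_le_mul_of_nonneg_left (Finset.sum_le_sum fun i _ => hψ (by gcongr)) (by positivity)

lemma localScore_sqrt_mul_eq_zero {ψ : ℝ → ℝ} {n : ℕ} {x : ℕ → ℝ} {δ : ℝ}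
    (h : ∑ i ∈ Finset.range n, ψ (x i - δ) = 0) : localScore ψ n x (√(n : ℝ) * δ) = 0 := by
  rcases n.eq_zero_or_pos with rfl | hn
  · simp [localScore]
  · have hs : √(n : ℝ) ≠ 0 := by positivity
    rw [localScore, mul_div_cancel_left₀ _ hs, h, mul_zero]

lemma abs_localScore_sub_le {ψ : ℝ → ℝ} (hψ : Differentiable ℝ ψ) {K : NNReal}
    (hK : LipschitzWith K (deriv ψ)) (n : ℕ) (x : ℕ → ℝ) (v : ℝ) :
    |localScore ψ n x v - ((√(n : ℝ))⁻¹ * ∑ i ∈ Finset.range n, ψ (x i) -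
        v * ((∑ i ∈ Finset.range n, deriv ψ (x i)) / n))| ≤ K / √(n : ℝ) * v ^ 2 := by
  rw [localScore]
  rcases n.eq_zero_or_pos with rfl | hn
  · simp
  set s := √(n : ℝ)
  have hs : 0 < s := by positivity
  have hsn : (n : ℝ) = s ^ 2 := (Real.sq_sqrt n.cast_nonneg).symm
  have htaylor (i : ℕ) :
      |ψ (x i - v / s) - ψ (x i) + v / s * deriv ψ (x i)| ≤ K * (v / s) ^ 2 := by
    simpa only [Real.norm_eq_abs, sq_abs, sub_sub_cancel_left, neg_smul, smul_eq_mul,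
      neg_mul, sub_neg_eq_add, neg_sq] using norm_sub_sub_smul_deriv_le hψ hK (x i) (x i - v / s)
  calc |s⁻¹ * ∑ i ∈ Finset.range n, ψ (x i - v / s) - (s⁻¹ * ∑ i ∈ Finset.range n, ψ (x i) -
        v * ((∑ i ∈ Finset.range n, deriv ψ (x i)) / n))|
      = |s⁻¹ * ∑ i ∈ Finset.range n, (ψ (x i - v / s) - ψ (x i) + v / s * deriv ψ (x i))| := by
        rw [Finset.sum_add_distrib, Finset.sum_sub_distrib, ← Finset.mul_sum, hsn]
        congr 1
        field_simp
        ring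
    _ = s⁻¹ * |∑ i ∈ Finset.range n, (ψ (x i - v / s) - ψ (x i) + v / s * deriv ψ (x i))| := by
        rw [abs_mul, abs_of_pos (inv_pos.2 hs)]
    _ ≤ s⁻¹ * ∑ _i ∈ Finset.range n, K * (v / s) ^ 2 := by
        gcongr
        exact (Finset.abs_sum_le_sum_abs _ _).trans (Finset.sum_le_sum fun i _ => htaylor i)
    _ = K / s * v ^ 2 := by
        rw [Finset.sum_const, Finset.card_range, nsmul_eq_mul, hsn]
        field_simp

variable {Ω : Type*} [MeasurableSpace Ω] {P : Measure Ω} [IsProbabilityMeasure P]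

lemma tendstoInMeasure_sum_div {V : ℕ → Ω → ℝ} (hindep : Pairwise fun i j => V i ⟂ᵢ[P] V j)
    (hident : ∀ i, IdentDistrib (V i) (V 0) P P) (hint : Integrable (V 0) P) :
    TendstoInMeasure P (fun (n : ℕ) ω => (∑ i ∈ Finset.range n, V i ω) / n) atTop
      fun _ => P[V 0] := by
  have hV (i : ℕ) : AEMeasurable (V i) P := (hident i).aemeasurable_fst
  exact tendstoInMeasure_of_tendsto_ae
    (fun n => AEMeasurable.aestronglyMeasurable (by fun_prop))
    (strong_law_ae_real V hint hindep hident)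

theorem tendstoInMeasure_sqrt_mul_root_sub {ξ : ℕ → Ω → ℝ}
    (hindep : Pairwise fun i j => ξ i ⟂ᵢ[P] ξ j) (hident : ∀ i, IdentDistrib (ξ i) (ξ 0) P P)
    {ψ : ℝ → ℝ} (hmono : Monotone ψ) (hψ : Differentiable ℝ ψ) {K : NNReal}
    (hK : LipschitzWith K (deriv ψ)) (hL2 : MemLp (fun ω => ψ (ξ 0 ω)) 2 P)
    (hmean : ∫ ω, ψ (ξ 0 ω) ∂P = 0) (hint : Integrable (fun ω => deriv ψ (ξ 0 ω)) P)
    (hpos : 0 < ∫ ω, deriv ψ (ξ 0 ω) ∂P) {δ : ℕ → Ω → ℝ}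
    (hδ : ∀ n, ∀ᵐ ω ∂P, ∑ i ∈ Finset.range n, ψ (ξ i ω - δ n ω) = 0) :
    TendstoInMeasure P (fun (n : ℕ) ω => √(n : ℝ) * δ n ω -
      ((√(n : ℝ))⁻¹ * ∑ i ∈ Finset.range n, ψ (ξ i ω)) / ∫ ω, deriv ψ (ξ 0 ω) ∂P) atTop 0 := by
  have hψm : Measurable ψ := hψ.continuous.measurable
  have hψ'm : Measurable (deriv ψ) := measurable_deriv ψ
  have hident_ψ (i : ℕ) : IdentDistrib (fun ω => ψ (ξ i ω)) (fun ω => ψ (ξ 0 ω)) P P :=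
    (hident i).comp hψm
  have hmemLp (i : ℕ) : MemLp (fun ω => ψ (ξ i ω)) 2 P := (hident_ψ i).memLp_iff.2 hL2
  have hscore : IsBoundedInProbability P atTop
      fun (n : ℕ) ω => (√(n : ℝ))⁻¹ * ∑ i ∈ Finset.range n, ψ (ξ i ω) := by
    refine isBoundedInProbability_of_variance_le
      (fun n => (memLp_finsetSum _ fun i _ => hmemLp i).const_mul _) (fun n => ?_) fun n =>
      variance_inv_sqrt_mul_sum_le (fun i j hij => (hindep hij).comp hψm hψm) hident_ψ hL2 n
    rw [integral_const_mul, integral_finsetSum _ fun i _ => (hmemLp i).integrable one_le_two]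
    simp [(hident_ψ _).integral_eq, hmean]
  have hslope := tendstoInMeasure_sum_div (V := fun i ω => deriv ψ (ξ i ω))
    (fun i j hij => (hindep hij).comp hψ'm hψ'm) (fun i => (hident i).comp hψ'm) hint
  have hrate : Tendsto (fun n : ℕ => (K : ℝ) / √(n : ℝ)) atTop (𝓝 0) :=
    tendsto_const_nhds.div_atTop (Real.tendsto_sqrt_atTop.comp tendsto_natCast_atTop_atTop)
  have hlin (n : ℕ) (ω : Ω) := abs_localScore_sub_le hψ hK n (ξ · ω)
  have hroot (n : ℕ) : ∀ᵐ ω ∂P, localScore ψ n (ξ · ω) (√(n : ℝ) * δ n ω) = 0 :=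
    (hδ n).mono fun ω => localScore_sqrt_mul_eq_zero
  refine tendstoInMeasure_sub_div_of_abs_mul_sub_le (fun n => ?_)
    (hscore.of_antitone_root (fun n ω => antitone_localScore hmono n (ξ · ω)) hlin hroot
      hslope hpos hrate) hslope hpos.ne' hrate
  filter_upwards [hroot n] with ω hω
  simpa only [hω, zero_sub, neg_sub] using hlin n ω (√(n : ℝ) * δ n ω)

end LocalScore

section MEstimation

open scoped Matrix

variable {p : ℕ} {ρ : Fin p → ℝ → ℝ}

/-- The multivariate score `ψ = (ψ₁, …, ψ_p)`, `ψ_j = ρ_j'`, of the loss `ρ₁(x₁) + ⋯ + ρ_p(x_p)`. -/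
noncomputable def score (ρ : Fin p → ℝ → ℝ) (x : EuclideanSpace ℝ (Fin p)) :
    EuclideanSpace ℝ (Fin p) :=
  WithLp.toLp 2 fun j => deriv (ρ j) (x j)

lemma hasGradientAt_separableLoss {x : EuclideanSpace ℝ (Fin p)}
    (hρ : ∀ j, DifferentiableAt ℝ (ρ j) (x j)) :
    HasGradientAt (separableLoss ρ) (score ρ x) x := by
  have hcoord (j : Fin p) : HasFDerivAt (fun y : EuclideanSpace ℝ (Fin p) => ρ j (y j))
      (deriv (ρ j) (x j) • (EuclideanSpace.proj j : EuclideanSpace ℝ (Fin p) →L[ℝ] ℝ)) x :=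
    (hρ j).hasDerivAt.comp_hasFDerivAt x (PiLp.hasFDerivAt_apply 2 x j)
  refine (HasFDerivAt.fun_sum fun j _ => hcoord j).congr_fderiv ?_
  ext v
  simp [score, PiLp.inner_apply, mul_comm]

lemma IsMEstimate.sum_score_eq_zero (hρ : ∀ j, Differentiable ℝ (ρ j)) {n : ℕ}
    {x : ℕ → EuclideanSpace ℝ (Fin p)} {β : EuclideanSpace ℝ (Fin p)} (h : IsMEstimate ρ n x β) :
    ∑ i ∈ Finset.range n, score ρ (x i - β) = 0 := by
  have hterm (i : ℕ) := (hasGradientAt_separableLoss (x := x i - β)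
    fun j => hρ j _).hasFDerivAt.comp β ((hasFDerivAt_id β).const_sub (x i))
  have hcrit := (h.isLocalMin Filter.univ_mem).hasFDerivAt_eq_zero
    (HasFDerivAt.fun_sum fun i (_ : i ∈ Finset.range n) => hterm i)
  refine (InnerProductSpace.toDual ℝ _).injective ?_
  simpa [← map_sum] using hcrit

variable {Ω : Type*} [MeasurableSpace Ω] {P : Measure Ω} {e : Ω → EuclideanSpace ℝ (Fin p)}

/-- The influence function `x ↦ Ϝ⁻¹ ψ(x)` of the M-estimator for errors distributed as `e`; its
averages over the errors are the linear part of the estimator. -/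
noncomputable def influence (ρ : Fin p → ℝ → ℝ) (P : Measure Ω) (e : Ω → EuclideanSpace ℝ (Fin p))
    (x : EuclideanSpace ℝ (Fin p)) : EuclideanSpace ℝ (Fin p) :=
  WithLp.toLp 2 ((digammaMatrix ρ P e)⁻¹ *ᵥ score ρ x)

lemma measurable_influence : Measurable (influence ρ P e) := by
  unfold influence score Matrix.mulVec dotProduct
  fun_prop

lemma influence_apply (hψ' : ∀ j, ∫ ω, deriv (deriv (ρ j)) (e ω j) ∂P ≠ 0)
    (x : EuclideanSpace ℝ (Fin p)) (j : Fin p) :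
    influence ρ P e x j = deriv (ρ j) (x j) / ∫ ω, deriv (deriv (ρ j)) (e ω j) ∂P := by
  have hinv : (digammaMatrix ρ P e)⁻¹ =
      Matrix.diagonal fun j => (∫ ω, deriv (deriv (ρ j)) (e ω j) ∂P)⁻¹ := by
    refine Matrix.inv_eq_right_inv ?_
    rw [digammaMatrix, Matrix.diagonal_mul_diagonal, ← Matrix.diagonal_one]
    exact congrArg _ (funext fun j => mul_inv_cancel₀ (hψ' j))
  simp [influence, hinv, Matrix.mulVec_diagonal, score, div_eq_inv_mul]

section Moments

variable (hψ_sq : ∀ j, MemLp (fun ω => deriv (ρ j) (e ω j)) 2 P)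
  (hψ_mean : ∀ j, ∫ ω, deriv (ρ j) (e ω j) ∂P = 0)

include hψ_sq

lemma memLp_score : MemLp (fun ω => score ρ (e ω)) 2 P := .of_eval_piLp hψ_sq

lemma memLp_influence : MemLp (fun ω => influence ρ P e (e ω)) 2 P :=
  memLp_toLp_mulVec (memLp_score hψ_sq) _

variable [IsProbabilityMeasure P]

include hψ_mean

lemma integral_score : ∫ ω, score ρ (e ω) ∂P = 0 := by
  ext j
  rw [eval_integral_piLp fun j => (hψ_sq j).integrable one_le_two]
  exact hψ_mean j

lemma integral_influence : ∫ ω, influence ρ P e (e ω) ∂P = 0 := by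
  simp only [influence]
  rw [integral_toLp_mulVec ((memLp_score hψ_sq).integrable one_le_two),
    integral_score hψ_sq hψ_mean, WithLp.ofLp_zero, Matrix.mulVec_zero, WithLp.toLp_zero]

lemma gammaMatrix_eq_covarianceMatrix :
    gammaMatrix ρ P e = covarianceMatrix (fun ω => score ρ (e ω)) P := by
  ext j k
  simp only [covarianceMatrix, score, Matrix.of_apply]
  rw [covariance_eq_sub (hψ_sq j) (hψ_sq k), hψ_mean j, zero_mul, sub_zero]
  rfl

lemma asymptoticCov_eq_covarianceMatrix :
    asymptoticCov ρ P e = covarianceMatrix (fun ω => influence ρ P e (e ω)) P := by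
  have hsymm : ((digammaMatrix ρ P e)⁻¹)ᵀ = (digammaMatrix ρ P e)⁻¹ := by
    rw [Matrix.transpose_nonsing_inv, digammaMatrix, Matrix.diagonal_transpose]
  have h := covarianceMatrix_toLp_mulVec (memLp_score hψ_sq) (digammaMatrix ρ P e)⁻¹
  rw [hsymm, ← gammaMatrix_eq_covarianceMatrix hψ_sq hψ_mean] at h
  exact h.symm

end Moments

lemma tendstoInMeasure_sqrt_smul_sub_influence [IsProbabilityMeasure P]
    {μ : EuclideanSpace ℝ (Fin p)} {X ε : ℕ → Ω → EuclideanSpace ℝ (Fin p)}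
    (hX : ∀ i ω, X i ω = μ + ε i ω)
    (hindep : Pairwise fun i j => ε i ⟂ᵢ[P] ε j) (hident : ∀ i, IdentDistrib (ε i) (ε 0) P P)
    (hconv : ∀ j, ConvexOn ℝ Set.univ (ρ j)) (hdiff : ∀ j, Differentiable ℝ (ρ j))
    (hdiff2 : ∀ j, Differentiable ℝ (deriv (ρ j)))
    (hψ_sq : ∀ j, MemLp (fun ω => deriv (ρ j) (ε 0 ω j)) 2 P)
    (hψ_mean : ∀ j, ∫ ω, deriv (ρ j) (ε 0 ω j) ∂P = 0)
    (hψ'_int : ∀ j, Integrable (fun ω => deriv (deriv (ρ j)) (ε 0 ω j)) P)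
    (hψ'_ne : ∀ j, ∫ ω, deriv (deriv (ρ j)) (ε 0 ω j) ∂P ≠ 0)
    (hψ'_lip : ∀ j, ∃ K : NNReal, LipschitzWith K (deriv (deriv (ρ j))))
    {μhat : ℕ → Ω → EuclideanSpace ℝ (Fin p)}
    (hμhat : ∀ n, ∀ᵐ ω ∂P, IsMEstimate ρ n (fun i => X i ω) (μhat n ω)) :
    TendstoInMeasure P (fun (n : ℕ) ω => √(n : ℝ) • (μhat n ω - μ) -
      (√(n : ℝ))⁻¹ • ∑ i ∈ Finset.range n, influence ρ P (ε 0) (ε i ω)) atTop 0 := by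
  refine tendstoInMeasure_piLp fun j => ?_
  have hmono : Monotone (deriv (ρ j)) :=
    monotoneOn_univ.1 ((hconv j).monotoneOn_deriv fun x _ => hdiff j x)
  have hpos : 0 < ∫ ω, deriv (deriv (ρ j)) (ε 0 ω j) ∂P :=
    (integral_nonneg fun ω => hmono.deriv_nonneg).lt_of_ne' (hψ'_ne j)
  have hcoord : Measurable fun x : EuclideanSpace ℝ (Fin p) => x j := by fun_prop
  have hroot (n : ℕ) : ∀ᵐ ω ∂P,
      ∑ i ∈ Finset.range n, deriv (ρ j) (ε i ω j - (μhat n ω - μ) j) = 0 := by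
    filter_upwards [hμhat n] with ω hω
    have hshift (i : ℕ) : X i ω - μhat n ω = ε i ω - (μhat n ω - μ) := by
      rw [hX]
      abel
    have h := congrArg (· j) (hω.sum_score_eq_zero hdiff)
    simpa [hshift, score] using h
  obtain ⟨K, hK⟩ := hψ'_lip j
  have hlin := tendstoInMeasure_sqrt_mul_root_sub (ξ := fun i ω => ε i ω j)
    (fun i k hik => (hindep hik).comp hcoord hcoord) (fun i => (hident i).comp hcoord) hmono
    (hdiff2 j) hK (hψ_sq j) (hψ_mean j) (hψ'_int j) hpos hroot
  refine hlin.congr (fun n => .of_forall fun ω => ?_) ae_eq_rfl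
  simp [influence_apply hψ'_ne, ← Finset.sum_div, mul_div_assoc]

end MEstimation

theorem theorem1_general {p : ℕ} {Ω : Type*} [MeasurableSpace Ω] (P : Measure Ω)
    [IsProbabilityMeasure P] (μ : EuclideanSpace ℝ (Fin p))
    (X ε : ℕ → Ω → EuclideanSpace ℝ (Fin p)) (hX : ∀ i ω, X i ω = μ + ε i ω)
    (hindep : iIndepFun ε P) (hident : ∀ i, IdentDistrib (ε i) (ε 0) P P)
    (ρ : Fin p → ℝ → ℝ)
    (hconv : ∀ j, ConvexOn ℝ Set.univ (ρ j)) (hdiff : ∀ j, Differentiable ℝ (ρ j))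
    (hdiff2 : ∀ j, Differentiable ℝ (deriv (ρ j)))
    (hψ_sq : ∀ j, MemLp (fun ω => deriv (ρ j) (ε 0 ω j)) 2 P)
    (hψ_mean : ∀ j, ∫ ω, deriv (ρ j) (ε 0 ω j) ∂P = 0)
    (hψ'_int : ∀ j, Integrable (fun ω => deriv (deriv (ρ j)) (ε 0 ω j)) P)
    (hψ'_ne : ∀ j, ∫ ω, deriv (deriv (ρ j)) (ε 0 ω j) ∂P ≠ 0)
    (hψ'_lip : ∀ j, ∃ K : NNReal, LipschitzWith K (deriv (deriv (ρ j))))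
    (μhat : ℕ → Ω → EuclideanSpace ℝ (Fin p)) (hμhat_meas : ∀ n, AEMeasurable (μhat n) P)
    (hμhat : ∀ n, ∀ᵐ ω ∂P, IsMEstimate ρ n (fun i => X i ω) (μhat n ω)) :
    (∀ j k, gammaMatrix ρ P (ε 0) j k =
      cov[fun ω => deriv (ρ j) (ε 0 ω j), fun ω => deriv (ρ k) (ε 0 ω k); P]) ∧
    (asymptoticCov ρ P (ε 0)).PosSemidef ∧
    TendstoInDistribution (fun (n : ℕ) ω => √(n : ℝ) • (μhat n ω - μ)) atTop id (fun _ => P)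
      (multivariateGaussian 0 (asymptoticCov ρ P (ε 0))) := by
  have hinfl : Measurable (influence ρ P (ε 0)) := measurable_influence
  have hL2 : MemLp (fun ω => influence ρ P (ε 0) (ε 0 ω)) 2 P := memLp_influence hψ_sq
  rw [asymptoticCov_eq_covarianceMatrix hψ_sq hψ_mean]
  refine ⟨fun j k => congr_fun₂ (gammaMatrix_eq_covarianceMatrix hψ_sq hψ_mean) j k,
    posSemidef_covarianceMatrix hL2, ?_⟩
  have hclt := tendstoInDistribution_multivariateGaussian (hindep.comp _ fun _ => hinfl)
    (fun i => (hident i).comp hinfl) hL2 (integral_influence hψ_sq hψ_mean)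
  exact tendstoInDistribution_of_tendstoInMeasure_sub _ _ hclt
    (tendstoInMeasure_sqrt_smul_sub_influence hX (fun i j hij => hindep.indepFun hij) hident hconv
      hdiff hdiff2 hψ_sq hψ_mean hψ'_int hψ'_ne hψ'_lip hμhat) fun n => by fun_prop

theorem theorem1 {p : ℕ} {Ω : Type*} [MeasurableSpace Ω] (P : Measure Ω) [IsProbabilityMeasure P]
    (μ : EuclideanSpace ℝ (Fin p))
    (X ε : ℕ → Ω → EuclideanSpace ℝ (Fin p))
    -- the model: i.i.d. errors with zero mean in `DS(α₁, …, α_p)`, `1 < α_j ≤ 2`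
    (hX : ∀ i ω, X i ω = μ + ε i ω)
    (hindep : iIndepFun ε P)
    (hident : ∀ i, IdentDistrib (ε i) (ε 0) P P)
    (hint : Integrable (ε 0) P) (hmean : ∫ ω, ε 0 ω ∂P = 0)
    (α : Fin p → ℝ) (hα : ∀ j, 1 < α j ∧ α j ≤ 2)
    (hDS : InDS α P ε)
    -- (A1)
    (ρ : Fin p → ℝ → ℝ)
    (hconv : ∀ j, ConvexOn ℝ Set.univ (ρ j))
    (hdiff : ∀ j, Differentiable ℝ (ρ j))
    (hdiff2 : ∀ j, Differentiable ℝ (deriv (ρ j)))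
    -- (A2)
    (hψ_sq : ∀ j, MemLp (fun ω => deriv (ρ j) (ε 0 ω j)) 2 P)
    (hψ_mean : ∀ j, ∫ ω, deriv (ρ j) (ε 0 ω j) ∂P = 0)
    (hψ'_int : ∀ j, Integrable (fun ω => deriv (deriv (ρ j)) (ε 0 ω j)) P)
    (hψ'_ne : ∀ j, ∫ ω, deriv (deriv (ρ j)) (ε 0 ω j) ∂P ≠ 0)
    -- (A3)
    (hψ'_lip : ∀ j, ∃ K : NNReal, LipschitzWith K (deriv (deriv (ρ j))))
    -- the M-estimators
    (μhat : ℕ → Ω → EuclideanSpace ℝ (Fin p))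
    (hμhat_meas : ∀ n, AEMeasurable (μhat n) P)
    (hμhat : ∀ n, ∀ᵐ ω ∂P, IsMEstimate ρ n (fun i => X i ω) (μhat n ω)) :
    (∀ j k, gammaMatrix ρ P (ε 0) j k =
      cov[fun ω => deriv (ρ j) (ε 0 ω j), fun ω => deriv (ρ k) (ε 0 ω k); P]) ∧
    (asymptoticCov ρ P (ε 0)).PosSemidef ∧
    TendstoInDistribution (fun (n : ℕ) ω => √(n : ℝ) • (μhat n ω - μ)) atTop id (fun _ => P)
      (multivariateGaussian 0 (asymptoticCov ρ P (ε 0))) := by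
  exact theorem1_general P μ X ε hX hindep hident ρ hconv hdiff hdiff2 hψ_sq hψ_mean hψ'_int
    hψ'_ne hψ'_lip μhat hμhat_meas hμhat
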